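/- Let $p$ be an odd prime, and for a profinite group $G$ write $H^i(G)=H^i(G,\mathbb{Z}/p)$ for continuous cohomology with trivial action, so that $H^1(G)$ is the group of continuous homomorphisms $G\to\mathbb{Z}/p$. Let $\beta_G\colon H^1(G)\to H^2(G)$ be the Bockstein homomorphism, i.e. the connecting homomorphism of $0\to\mathbb{Z}/p\xrightarrow{\,i\mapsto pi\,}\mathbb{Z}/p^2\to\mathbb{Z}/p\to0$. Say that $G$ has Galois relation type if 1. the kernel of the homomorphism $\cup\colon H^1(G)\otimes_{\mathbb{Z}}H^1(G)\to H^2(G)$ is generated by elements of the form $\psi\otimes\psi'$ with $\psi,\psi'\in H^1(G)$; and 2. there exists $\xi\in H^1(G)$ such that $\psi\cup\xi+\beta_G(\psi)=0$ for every $\psi\in H^1(G)$. Let $M_{p^3}=\langle r,s\mid r^{p^2}=s^p=1,\ [r,s]=r^p\rangle$, where $[r,s]=r^{-1}s^{-1}rs$. **Proposition 10.2.** Let $p$ be an odd prime and let $G$ be a profinite group of Galois relation type. Then every continuous epimorphism $\psi\colon G\to\mathbb{Z}/p$ can be written as $\psi=\pi\circ\Phi$, where $\Phi\colon G\to\bar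 G$ is a continuous epimorphism and either (i) $\bar G=\mathbb{Z}/p^2$ and $\pi\colon\mathbb{Z}/p^2\to\mathbb{Z}/p$ is the natural map; or (ii) $\bar G=M_{p^3}$ (with the discrete topology) and $\pi\colon M_{p^3}\to\mathbb{Z}/p$ is the homomorphism with $r\mapsto\bar1$, $s\mapsto\bar0$. -/

import Mathlib

open scoped TensorProduct

noncomputable section

namespace GaloisRel

/-! ### Continuous cohomology with coefficients in `ℤ/q` (trivial action, discrete topology) -/

/-- `H¹(G, ℤ/q)`: the additive group of continuous homomorphisms `G → ℤ/q`. -/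
abbrev H1 (G : Type*) [Group G] [TopologicalSpace G] (q : ℕ) : Type _ :=
  Additive (G →ₜ* Multiplicative (ZMod q))

section Cohomology

variable {G : Type*} [Group G] [TopologicalSpace G] {q : ℕ}

/-- The value of `ψ ∈ H¹(G, ℤ/q)` at `g`, as an element of `ℤ/q`. -/
def H1.eval (ψ : H1 G q) (g : G) : ZMod q := (ψ.toMul g).toAdd

theorem H1.eval_mul (ψ : H1 G q) (g h : G) : ψ.eval (g * h) = ψ.eval g + ψ.eval h := by
  simp [H1.eval]

theorem H1.eval_add (ψ χ : H1 G q) (g : G) : (ψ + χ).eval g = ψ.eval g + χ.eval g := rfl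

theorem H1.continuous_eval (ψ : H1 G q) : Continuous ψ.eval :=
  continuous_toAdd.comp ψ.toMul.continuous_toFun

variable (G q) [ContinuousMul G]

/-- The coboundary on continuous inhomogeneous `1`-cochains:
`(∂f)(g, h) = f(h) - f(gh) + f(g)`. -/
def d1 : C(G, ZMod q) →+ C(G × G, ZMod q) where
  toFun f := ⟨fun x => f x.2 - f (x.1 * x.2) + f x.1, by fun_prop⟩
  map_zero' := by ext; simp
  map_add' f f' := by ext; simp; ring

/-- The coboundary on continuous inhomogeneous `2`-cochains:
`(∂f)(g, h, k) = f(h, k) - f(gh, k) + f(g, hk) - f(g, h)`. -/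
def d2 : C(G × G, ZMod q) →+ C(G × G × G, ZMod q) where
  toFun f := ⟨fun x => f (x.2.1, x.2.2) - f (x.1 * x.2.1, x.2.2)
    + f (x.1, x.2.1 * x.2.2) - f (x.1, x.2.1), by fun_prop⟩
  map_zero' := by ext; simp
  map_add' f f' := by ext; simp; ring

/-- `H²(G, ℤ/q)`: continuous `2`-cocycles modulo coboundaries of continuous `1`-cochains. -/
abbrev H2 : Type _ := (d2 G q).ker ⧸ ((d1 G q).range.addSubgroupOf (d2 G q).ker)

variable {G q}

/-- The class in `H²(G, ℤ/q)` of a continuous `2`-cocycle. -/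
def H2.mk (f : C(G × G, ZMod q)) (hf : f ∈ (d2 G q).ker) : H2 G q :=
  QuotientAddGroup.mk ⟨f, hf⟩

theorem H2.mk_eq_mk_iff {f f' : C(G × G, ZMod q)} {hf : f ∈ (d2 G q).ker}
    {hf' : f' ∈ (d2 G q).ker} :
    H2.mk f hf = H2.mk f' hf' ↔ ∃ u : C(G, ZMod q), d1 G q u = f' - f := by
  rw [H2.mk, H2.mk, QuotientAddGroup.eq, AddSubgroup.mem_addSubgroupOf, AddMonoidHom.mem_range]
  simp [neg_add_eq_sub]

/-! ### Cup products -/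

/-- The cocycle `(g, h) ↦ ψ(g) ψ'(h)`. -/
def cupCocycle (ψ ψ' : H1 G q) : C(G × G, ZMod q) :=
  ⟨fun x => ψ.eval x.1 * ψ'.eval x.2,
    (ψ.continuous_eval.comp continuous_fst).mul (ψ'.continuous_eval.comp continuous_snd)⟩

theorem cupCocycle_mem (ψ ψ' : H1 G q) : cupCocycle ψ ψ' ∈ (d2 G q).ker := by
  rw [AddMonoidHom.mem_ker]
  ext x
  simp [d2, cupCocycle, H1.eval_mul]
  ring

variable (G q)

/-- The cup product `H¹(G, ℤ/q) × H¹(G, ℤ/q) → H²(G, ℤ/q)`, as a biadditive map. -/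
def cup : H1 G q →+ H1 G q →+ H2 G q :=
  AddMonoidHom.mk' (fun ψ => AddMonoidHom.mk' (fun ψ' => H2.mk (cupCocycle ψ ψ')
      (cupCocycle_mem ψ ψ'))
    (fun a b => by
      change _ = QuotientAddGroup.mk (_ + _)
      refine congrArg QuotientAddGroup.mk (Subtype.ext (ContinuousMap.ext fun x => ?_))
      simp [cupCocycle, H1.eval_add, mul_add]))
    (fun a b => by
      ext ψ'
      change _ = QuotientAddGroup.mk (_ + _)
      refine congrArg QuotientAddGroup.mk (Subtype.ext (ContinuousMap.ext fun x => ?_))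
      simp [cupCocycle, H1.eval_add, add_mul])

/-- The homomorphism `H¹(G, ℤ/q) ⊗_ℤ H¹(G, ℤ/q) → H²(G, ℤ/q)` extending the cup product. -/
def cupTensor : H1 G q ⊗[ℤ] H1 G q →+ H2 G q :=
  TensorProduct.liftAddHom (cup G q) (fun n ψ ψ' => by simp)

variable {G q}

/-! ### The Bockstein homomorphism -/

/-- The carrying cocycle: for the set-theoretic section `s : ℤ/q → ℤ/q²` with values represented by
`0, …, q - 1`, one has `s(a) + s(b) - s(a + b) = q · ⌊(a + b) / q⌋`, where on the right
`a` and `b` are the representatives. -/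
def bocksteinCocycle (ψ : H1 G q) : C(G × G, ZMod q) :=
  ⟨fun x => (((ψ.eval x.1).val + (ψ.eval x.2).val) / q : ℕ),
    (continuous_of_discreteTopology (f := fun y : ZMod q × ZMod q =>
      (((y.1.val + y.2.val) / q : ℕ) : ZMod q))).comp
      ((ψ.continuous_eval.comp continuous_fst).prodMk (ψ.continuous_eval.comp continuous_snd))⟩

theorem carry_eq [NeZero q] (a b : ZMod q) :
    (q : ℤ) * ((a.val + b.val) / q : ℕ) = a.val + b.val - (a + b).val := by
  rw [ZMod.val_add]
  have := Nat.div_add_mod (a.val + b.val) q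
  push_cast
  have h : (q : ℤ) * (((a.val : ℤ) + b.val) / q) + ((a.val : ℤ) + b.val) % q = a.val + b.val := by
    exact_mod_cast this
  linarith

theorem bocksteinCocycle_mem [NeZero q] (ψ : H1 G q) :
    bocksteinCocycle ψ ∈ (d2 G q).ker := by
  rw [AddMonoidHom.mem_ker]
  ext x
  simp only [d2, bocksteinCocycle, AddMonoidHom.coe_mk, ZeroHom.coe_mk, ContinuousMap.coe_mk,
    ContinuousMap.zero_apply, H1.eval_mul]
  generalize ψ.eval x.1 = a
  generalize ψ.eval x.2.1 = b
  generalize ψ.eval x.2.2 = c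
  have h1 := carry_eq b c
  have h2 := carry_eq (a + b) c
  have h3 := carry_eq a (b + c)
  have h4 := carry_eq a b
  rw [← add_assoc] at h3
  have hq : (q : ℤ) ≠ 0 := by exact_mod_cast NeZero.ne q
  have : (((b.val + c.val) / q : ℕ) : ℤ) - (((a + b).val + c.val) / q : ℕ)
      + ((a.val + (b + c).val) / q : ℕ) - ((a.val + b.val) / q : ℕ) = 0 := by
    apply mul_left_cancel₀ hq
    linear_combination h1 - h2 + h3 - h4
  have h := congrArg (Int.cast : ℤ → ZMod q) this
  simpa only [Int.cast_sub, Int.cast_add, Int.cast_natCast, Int.cast_zero] using h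

/-- The Bockstein map `β_G : H¹(G, ℤ/q) → H²(G, ℤ/q)`: the connecting map of
`0 → ℤ/q → ℤ/q² → ℤ/q → 0`, where the first map is `i ↦ q i`; see `bockstein_eq_of_lift`. -/
def bockstein [NeZero q] (ψ : H1 G q) : H2 G q :=
  H2.mk (bocksteinCocycle ψ) (bocksteinCocycle_mem ψ)

/-- `β_G` is the connecting map: if a continuous `1`-cochain `f : G → ℤ/q²` lifts `ψ` and
`∂f = q · z` for a continuous `2`-cocycle `z : G × G → ℤ/q`, then `β_G(ψ)` is the class of `z`. -/
theorem bockstein_eq_of_lift [NeZero q] (ψ : H1 G q) (f : C(G, ZMod (q ^ 2)))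
    (hf : ∀ g, ((f g).val : ZMod q) = ψ.eval g) (z : C(G × G, ZMod q)) (hz : z ∈ (d2 G q).ker)
    (hfz : ∀ x, d1 G (q ^ 2) f x = ((q * (z x).val : ℕ) : ZMod (q ^ 2))) :
    bockstein ψ = H2.mk z hz := by
  have hq : (q : ℤ) ≠ 0 := by exact_mod_cast NeZero.ne q
  have hq2 : NeZero (q ^ 2) := ⟨pow_ne_zero 2 (NeZero.ne q)⟩
  -- `f g` and the representative of `ψ g` differ by `q` times `⌊f g / q⌋`
  have key : ∀ g, ((f g).val : ℤ) = (ψ.eval g).val + q * (((f g).val / q : ℕ) : ℤ) := by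
    intro g
    rw [← hf g, ZMod.val_natCast]
    exact_mod_cast (Nat.mod_add_div (f g).val q).symm
  rw [bockstein, H2.mk_eq_mk_iff]
  refine ⟨⟨fun g => (((f g).val / q : ℕ) : ZMod q),
    (continuous_of_discreteTopology (f := fun y : ZMod (q ^ 2) =>
      ((y.val / q : ℕ) : ZMod q))).comp f.continuous⟩, ?_⟩
  ext ⟨g, h⟩
  have e := hfz (g, h)
  simp only [d1, AddMonoidHom.coe_mk, ZeroHom.coe_mk, ContinuousMap.coe_mk] at e ⊢
  have e' : (((f h).val - (f (g * h)).val + (f g).val - q * (z (g, h)).val : ℤ) :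
      ZMod (q ^ 2)) = 0 := by
    push_cast at e ⊢
    simp only [ZMod.natCast_zmod_val] at e ⊢
    rw [e, sub_self]
  rw [ZMod.intCast_zmod_eq_zero_iff_dvd] at e'
  obtain ⟨k, hk⟩ := e'
  have c := carry_eq (ψ.eval g) (ψ.eval h)
  rw [← H1.eval_mul] at c
  have main : (((f h).val / q : ℕ) : ℤ) - ((f (g * h)).val / q : ℕ) + ((f g).val / q : ℕ)
      = (z (g, h)).val - (((ψ.eval g).val + (ψ.eval h).val) / q : ℕ) + q * k := by
    apply mul_left_cancel₀ hq
    have k1 := key h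
    have k2 := key (g * h)
    have k3 := key g
    push_cast at hk
    linear_combination hk - k1 + k2 - k3 + c
  have m := congrArg (Int.cast : ℤ → ZMod q) main
  simp only [Int.cast_sub, Int.cast_add, Int.cast_mul, Int.cast_natCast, ZMod.natCast_self,
    zero_mul, add_zero, ZMod.natCast_zmod_val] at m
  simpa [bocksteinCocycle] using m

end Cohomology

/-! ### Groups of Galois relation type -/

/-- The natural map `ℤ/n → ℤ/m`, for `m ∣ n`. -/
def reduction {m n : ℕ} (h : m ∣ n) : Multiplicative (ZMod n) →ₜ* Multiplicative (ZMod m) where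
  toMonoidHom := AddMonoidHom.toMultiplicative (ZMod.castHom h (ZMod m)).toAddMonoidHom
  continuous_toFun := continuous_of_discreteTopology

/-- The natural map `H¹(G, ℤ/n) → H¹(G, ℤ/m)`, for `m ∣ n`. -/
def H1.reduce {G : Type*} [Group G] [TopologicalSpace G] {m n : ℕ} (h : m ∣ n) (ψ : H1 G n) :
    H1 G m :=
  Additive.ofMul ((reduction h).comp ψ.toMul)

/-- A topological group `G` has Galois relation type with respect to the prime power `q`.
(In `reduce_surjective` the divisors of `q = p ^ d` are `1`, for which there is nothing to show,
and `p ^ i` with `1 ≤ i ≤ d`.) -/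
structure IsGaloisRelationType (q : ℕ) [NeZero q] (G : Type*) [Group G] [TopologicalSpace G]
    [ContinuousMul G] : Prop where
  /-- The kernel of `H¹(G) ⊗ H¹(G) → H²(G)` is generated by elements of the form `ψ ⊗ ψ'`. -/
  ker_cup : (cupTensor G q).ker =
    AddSubgroup.closure {t | t ∈ (cupTensor G q).ker ∧ ∃ ψ ψ' : H1 G q, t = ψ ⊗ₜ[ℤ] ψ'}
  /-- There is a `ξ` with `ψ ∪ ξ + β_G(ψ) = 0` for all `ψ`. -/
  exists_bockstein : ∃ ξ : H1 G q, ∀ ψ : H1 G q, cup G q ψ ξ + bockstein ψ = 0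
  /-- The maps `H¹(G, ℤ/q) → H¹(G, ℤ/m)` are surjective for all `m ∣ q`. -/
  reduce_surjective : ∀ (m : ℕ) (h : m ∣ q),
    Function.Surjective (H1.reduce h : H1 G q → H1 G m)

/-! ### The modular group of order `p³` -/

/-- The defining relators of `⟨r, s | r^(p²) = s^p = 1, [r, s] = r^p⟩`, where
`[r, s] = r⁻¹ s⁻¹ r s`; the generators `r`, `s` are indexed by `0`, `1`. -/
def modularRels (p : ℕ) : Set (FreeGroup (Fin 2)) :=
  let r := FreeGroup.of 0
  let s := FreeGroup.of 1
  {r ^ (p ^ 2), s ^ p, r⁻¹ * s⁻¹ * r * s * (r ^ p)⁻¹}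

/-- The modular group `M_{p³} = ⟨r, s | r^(p²) = s^p = 1, [r, s] = r^p⟩`. -/
def ModularGroup (p : ℕ) : Type := PresentedGroup (modularRels p)

namespace ModularGroup

variable (p : ℕ)

instance : Group (ModularGroup p) := inferInstanceAs (Group (PresentedGroup (modularRels p)))

instance : TopologicalSpace (ModularGroup p) := ⊥

instance : DiscreteTopology (ModularGroup p) := ⟨rfl⟩

/-- The generator `r`. -/
def r : ModularGroup p := PresentedGroup.of (rels := modularRels p) 0

/-- The generator `s`. -/
def s : ModularGroup p := PresentedGroup.of (rels := modularRels p) 1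

theorem lift_rels : ∀ w ∈ modularRels p,
    FreeGroup.lift (![Multiplicative.ofAdd 1, 1] : Fin 2 → Multiplicative (ZMod p)) w = 1 := by
  have h : (Multiplicative.ofAdd (1 : ZMod p)) ^ p = 1 := by
    rw [← ofAdd_nsmul]; simp
  rintro w (rfl | rfl | rfl)
  · simp [pow_two, pow_mul, h]
  · simp
  · simp [h]

/-- The homomorphism `M_{p³} → ℤ/p` with `r ↦ 1`, `s ↦ 0`. -/
def toZMod : ModularGroup p →ₜ* Multiplicative (ZMod p) where
  toMonoidHom := PresentedGroup.toGroup (lift_rels p)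
  continuous_toFun := continuous_of_discreteTopology

theorem toZMod_r : (toZMod p (r p)).toAdd = 1 :=
  congrArg Multiplicative.toAdd (PresentedGroup.toGroup.of (lift_rels p) (x := 0))

theorem toZMod_s : (toZMod p (s p)).toAdd = 0 :=
  congrArg Multiplicative.toAdd (PresentedGroup.toGroup.of (lift_rels p) (x := 1))

end ModularGroup

end GaloisRel
end

open GaloisRel

/-! ### Arithmetic of `ℤ/p²` modulo the square-zero ideal `(p)` -/

section ZModSq

variable {p : ℕ}

/-! At cochain level, `ψ ∪ ξ + β(ψ) = 0` says that the naive lift of `ψ` to `ℤ/p²` can be corrected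
by a multiple of `p` to some `A` with `A(gh) = A(g)(1 + pξ(h)) + A(h)` (`exists_crossed_lift`). This
is exactly the rule for multiplying elements `s^ξ(g) r^A(g)` of `M_{p³}`, since `r^a s^b = s^b
r^(a(1 + bp))`; so `(ξ, A)` defines a homomorphism to `M_{p³}` (`ofCrossed`), which is onto when `ψ`
and `ξ` are independent. Otherwise `ξ = cψ`, the defect `pcA(g)A(h)` is symmetric, and for odd `p`
it is removed by subtracting `p(c/2)A²`, leaving a homomorphism to `ℤ/p²` (`exists_hom_lift`). -/

theorem ZMod.natCast_self_mul_self_sq : (p : ZMod (p ^ 2)) * p = 0 := by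
  rw [← Nat.cast_mul, ← pow_two, ZMod.natCast_self]

/-- Multiplication by `p` on `ℤ/p²` factors through `ℤ/p`. -/
theorem ZMod.natCast_mul_eq_of_castHom_eq [NeZero p] {x y : ZMod (p ^ 2)}
    (h : ZMod.castHom (dvd_pow_self p two_ne_zero) (ZMod p) x =
      ZMod.castHom (dvd_pow_self p two_ne_zero) (ZMod p) y) :
    (p : ZMod (p ^ 2)) * x = p * y := by
  obtain ⟨z, rfl⟩ : ∃ z, x = y + z := ⟨x - y, by ring⟩
  rw [map_add, add_eq_left] at h
  have : NeZero (p ^ 2) := ⟨pow_ne_zero 2 (NeZero.ne p)⟩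
  rw [← ZMod.natCast_zmod_val z, map_natCast, ZMod.natCast_eq_zero_iff] at h
  obtain ⟨k, hk⟩ := h
  have hp := ZMod.natCast_self_mul_self_sq (p := p)
  rw [mul_add, ← ZMod.natCast_zmod_val z, hk, Nat.cast_mul, ← mul_assoc, hp, zero_mul, add_zero]

/-- Units are detected modulo `p`; both surjectivity arguments use this to invert a value of a lift.
-/
theorem ZMod.isUnit_of_castHom_ne_zero [Fact p.Prime] {x : ZMod (p ^ 2)}
    (h : ZMod.castHom (dvd_pow_self p two_ne_zero) (ZMod p) x ≠ 0) : IsUnit x := by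
  rw [← ZMod.natCast_zmod_val x, map_natCast, Ne, ZMod.natCast_eq_zero_iff] at h
  rw [← ZMod.natCast_zmod_val x, ZMod.isUnit_iff_coprime]
  exact (((Fact.out : p.Prime).coprime_iff_not_dvd.2 h).symm).pow_right 2

end ZModSq

/-! ### Exponents modulo `n` and the normal form -/

section PowVal

variable {M : Type*} [Group M]

theorem pow_eq_pow_of_natCast_eq {n a b : ℕ} {x : M} (hx : x ^ n = 1)
    (h : (a : ZMod n) = b) : x ^ a = x ^ b := by
  rw [ZMod.natCast_eq_natCast_iff] at h
  exact pow_eq_pow_iff_modEq.2 (h.of_dvd (orderOf_dvd_of_pow_eq_one hx))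

/-- The normal form of products in the modular group. -/
theorem pow_mul_pow_of_inv_conj {p : ℕ} {r s : M} (hr : r ^ (p ^ 2) = 1)
    (hrs : r * s = s * r ^ (1 + p)) (a b : ℕ) : r ^ a * s ^ b = s ^ b * r ^ (a * (1 + b * p)) := by
  have h1 : ∀ n : ℕ, r ^ n * s = s * r ^ (n * (1 + p)) := fun n => by
    have : SemiconjBy s (r ^ (1 + p)) r := hrs.symm
    rw [mul_comm n, pow_mul]
    exact (this.pow_right n).symm
  induction b with
  | zero => simp
  | succ b ih =>
    rw [pow_succ, ← mul_assoc, ih, mul_assoc, h1, ← mul_assoc, mul_right_inj]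
    refine pow_eq_pow_of_natCast_eq hr ?_
    have := ZMod.natCast_self_mul_self_sq (p := p)
    push_cast
    -- `(1 + bp)(1 + p)` exceeds `1 + (b + 1)p` by `bp²`.
    linear_combination (a * b : ZMod (p ^ 2)) * this

end PowVal

namespace GaloisRel

/-! ### Lifting `ψ` to `ℤ/p²` -/

section Lift

variable {p : ℕ} [Fact p.Prime] {G : Type*} [Group G] [TopologicalSpace G] [ContinuousMul G]

/-- A relation `ψ ∪ ξ + β(ψ) = 0` yields a lift of `ψ` to a crossed homomorphism into `ℤ/p²`, on
which `G` acts through `ξ`. -/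
theorem exists_crossed_lift (ψ ξ : H1 G p) (h : cup G p ψ ξ + bockstein ψ = 0) :
    ∃ A : C(G, ZMod (p ^ 2)),
      (∀ g, ZMod.castHom (dvd_pow_self p two_ne_zero) (ZMod p) (A g) = ψ.eval g) ∧
      ∀ g h, A (g * h) =
      A g + A h + (p : ZMod (p ^ 2)) * (((ξ.eval h).val : ZMod (p ^ 2)) * A g) := by
  have e : H2.mk (-bocksteinCocycle ψ) (neg_mem (bocksteinCocycle_mem ψ)) =
      H2.mk (cupCocycle ψ ξ) (cupCocycle_mem ψ ξ) := (eq_neg_of_add_eq_zero_left h).symm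
  rw [H2.mk_eq_mk_iff] at e
  obtain ⟨u, hu⟩ := e
  -- The coboundary of the representative of `ψ` is `p` times the carry, and that of `u` is cup plus
  -- carry. Subtracting `p * u` cancels the carry and leaves `-pψ(g)ξ(h)`.
  refine ⟨⟨fun g => ((ψ.eval g).val : ZMod (p ^ 2)) - p * ((u g).val : ZMod (p ^ 2)), ?_⟩,
    fun g => ?_, fun g h => ?_⟩
  · exact (continuous_of_discreteTopology (f := fun y : ZMod p × ZMod p =>
      ((y.1.val : ZMod (p ^ 2)) - (p : ZMod (p ^ 2)) * (y.2.val : ZMod (p ^ 2))))).comp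
        (ψ.continuous_eval.prodMk u.continuous)
  · simp only [ContinuousMap.coe_mk, map_sub, map_mul, map_natCast, ZMod.natCast_self, zero_mul,
      sub_zero, ZMod.natCast_zmod_val]
  · have hu' := DFunLike.congr_fun hu (g, h)
    have carry := congrArg (Int.cast : ℤ → ZMod (p ^ 2)) (carry_eq (ψ.eval g) (ψ.eval h))
    rw [← H1.eval_mul] at carry
    simp only [d1, cupCocycle, bocksteinCocycle, AddMonoidHom.coe_mk, ZeroHom.coe_mk,
      ContinuousMap.coe_mk, ContinuousMap.sub_apply, ContinuousMap.neg_apply] at hu'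
    simp only [ContinuousMap.coe_mk]
    generalize ((ψ.eval g).val + (ψ.eval h).val) / p = c at carry hu'
    push_cast at carry
    have key := ZMod.natCast_mul_eq_of_castHom_eq (p := p)
      (x := (u h).val - (u (g * h)).val + (u g).val)
      (y := (ψ.eval g).val * (ξ.eval h).val + c) (by
        simpa only [map_sub, map_add, map_mul, map_natCast, ZMod.natCast_zmod_val, sub_neg_eq_add]
          using hu')
    have hp := ZMod.natCast_self_mul_self_sq (p := p)
    -- The last term replaces `ψ(g)` by `A(g)` in the defect: they differ by a multiple of `p`.
    linear_combination key + carry + (ξ.eval h).val * (u g).val * hp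

/-- If `ξ` is a multiple of `ψ`, then a crossed lift can be corrected to a homomorphism. -/
theorem exists_hom_lift (hp2 : p ≠ 2) (ψ ξ : H1 G p) (h : cup G p ψ ξ + bockstein ψ = 0)
    (c : ZMod p) (hc : ∀ g, ξ.eval g = c * ψ.eval g) :
    ∃ Φ : G →ₜ* Multiplicative (ZMod (p ^ 2)),
      ψ.toMul = (reduction (dvd_pow_self p two_ne_zero)).comp Φ := by
  obtain ⟨A, hA, hm⟩ := exists_crossed_lift ψ ξ h
  have hp := ZMod.natCast_self_mul_self_sq (p := p)
  obtain ⟨t, ht⟩ : ∃ t : ZMod (p ^ 2), 2 * t = (c.val : ZMod (p ^ 2)) := by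
    have h2 : IsUnit (2 : ZMod (p ^ 2)) := by
      have := (ZMod.isUnit_iff_coprime 2 (p ^ 2)).2
        (((Nat.coprime_primes Nat.prime_two Fact.out).2 hp2.symm).pow_right 2)
      exact_mod_cast this
    obtain ⟨v, hv⟩ := h2
    exact ⟨v⁻¹ * (c.val : ZMod (p ^ 2)), by rw [← hv, Units.mul_inv_cancel_left]⟩
  -- The cross term of `p t A(gh)²` is `2ptA(g)A(h) = pcA(g)A(h)`, the defect of `A`.
  refine ⟨⟨MonoidHom.mk' (fun g => Multiplicative.ofAdd (A g - (p : ZMod (p ^ 2)) * (t * A g ^ 2)))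
    fun g h => ?_, ?_⟩, ?_⟩
  · rw [← ofAdd_add]
    congr 1
    have key := ZMod.natCast_mul_eq_of_castHom_eq (p := p)
      (x := ((ξ.eval h).val : ZMod (p ^ 2))) (y := (c.val : ZMod (p ^ 2)) * A h) (by
        simp only [map_mul, map_natCast, ZMod.natCast_zmod_val, hA, hc])
    rw [hm]
    generalize ((ξ.eval h).val : ZMod (p ^ 2)) = x at key
    linear_combination A g * key - (p : ZMod (p ^ 2)) * A g * A h * ht -
      (2 * t * (A g + A h) * (x * A g) + t * (p : ZMod (p ^ 2)) * (x * A g) ^ 2) * hp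
  · exact (continuous_of_discreteTopology (f := fun y : ZMod (p ^ 2) =>
      Multiplicative.ofAdd (y - (p : ZMod (p ^ 2)) * (t * y ^ 2)))).comp A.continuous
  · ext g
    refine congrArg Multiplicative.ofAdd (a₁ := ψ.eval g)
      (a₂ := ZMod.castHom (dvd_pow_self p two_ne_zero) (ZMod p)
        (A g - (p : ZMod (p ^ 2)) * (t * A g ^ 2))) ?_
    rw [map_sub, map_mul, map_natCast, hA, ZMod.natCast_self, zero_mul, sub_zero]

end Lift

/-- A lift to `ℤ/p²` of an epimorphism to `ℤ/p` is an epimorphism. -/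
theorem surjective_of_reduction_comp_surjective {p : ℕ} [Fact p.Prime] {G : Type*}
    [Group G] [TopologicalSpace G] (Φ : G →ₜ* Multiplicative (ZMod (p ^ 2)))
    (h : Function.Surjective ((reduction (dvd_pow_self p two_ne_zero)).comp Φ)) :
    Function.Surjective Φ := by
  intro y
  obtain ⟨g, hg⟩ := h (Multiplicative.ofAdd 1)
  have hu : IsUnit (Φ g).toAdd := ZMod.isUnit_of_castHom_ne_zero (p := p) (by
    have : ZMod.castHom (dvd_pow_self p two_ne_zero) (ZMod p) (Φ g).toAdd = 1 :=
      congrArg Multiplicative.toAdd hg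
    rw [this]
    exact one_ne_zero)
  obtain ⟨v, hv⟩ := hu
  -- `Φ g` generates, so the exponent is the quotient of `y` by it.
  refine ⟨g ^ (y.toAdd * (v⁻¹ : (ZMod (p ^ 2))ˣ)).val, ?_⟩
  apply Multiplicative.toAdd.injective
  rw [map_pow, toAdd_pow, nsmul_eq_mul, ZMod.natCast_zmod_val, ← hv, Units.inv_mul_cancel_right]

/-! ### Homomorphisms to `M_{p³}` -/

namespace ModularGroup

section Relations

variable (p : ℕ)

theorem r_pow : r p ^ (p ^ 2) = 1 :=
  PresentedGroup.one_of_mem (rels := modularRels p) (Or.inl rfl)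

theorem s_pow : s p ^ p = 1 :=
  PresentedGroup.one_of_mem (rels := modularRels p) (Or.inr (Or.inl rfl))

theorem r_mul_s : r p * s p = s p * r p ^ (1 + p) := by
  have h : (r p)⁻¹ * (s p)⁻¹ * r p * s p * (r p ^ p)⁻¹ = 1 :=
    PresentedGroup.one_of_mem (rels := modularRels p) (Or.inr (Or.inr rfl))
  rw [mul_inv_eq_one] at h
  rw [pow_add, pow_one, ← h]
  group

theorem eq_top_of_r_mem_of_s_mem {H : Subgroup (ModularGroup p)} (hr : r p ∈ H) (hs : s p ∈ H) :
    H = ⊤ := by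
  rw [eq_top_iff]
  refine (PresentedGroup.closure_range_of (modularRels p)).symm.le.trans
    ((Subgroup.closure_le H).2 ?_)
  rintro _ ⟨i, rfl⟩
  fin_cases i
  exacts [hr, hs]

end Relations

variable {p : ℕ} [Fact p.Prime] {G : Type*} [Group G] [TopologicalSpace G]

/-- The homomorphism to `M_{p³}` with components `A` and `ξ`. -/
def ofCrossed (ξ : H1 G p) (A : C(G, ZMod (p ^ 2)))
    (hm : ∀ g h, A (g * h) =
      A g + A h + (p : ZMod (p ^ 2)) * (((ξ.eval h).val : ZMod (p ^ 2)) * A g)) :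
    G →ₜ* ModularGroup p where
  toMonoidHom := MonoidHom.mk' (fun g => s p ^ (ξ.eval g).val * r p ^ (A g).val) fun g h => by
    -- Moving `r^A(g)` to the right of `s^ξ(h)` multiplies its exponent by `1 + pξ(h)`, as `hm`
    -- requires.
    rw [mul_assoc, ← mul_assoc (r p ^ _), pow_mul_pow_of_inv_conj (r_pow p) (r_mul_s p),
      mul_assoc (s p ^ _) (r p ^ _), ← mul_assoc, ← pow_add, ← pow_add]
    congr 1
    · exact pow_eq_pow_of_natCast_eq (s_pow p) (by simp [H1.eval_mul])
    · refine pow_eq_pow_of_natCast_eq (r_pow p) ?_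
      push_cast
      simp only [ZMod.natCast_zmod_val]
      rw [hm]
      ring
  continuous_toFun := (continuous_of_discreteTopology (f := fun y : ZMod p × ZMod (p ^ 2) =>
    s p ^ y.1.val * r p ^ y.2.val)).comp (ξ.continuous_eval.prodMk A.continuous)

theorem ofCrossed_apply (ξ : H1 G p) (A : C(G, ZMod (p ^ 2)))
    (hm : ∀ g h, A (g * h) =
      A g + A h + (p : ZMod (p ^ 2)) * (((ξ.eval h).val : ZMod (p ^ 2)) * A g)) (g : G) :
    ofCrossed ξ A hm g = s p ^ (ξ.eval g).val * r p ^ (A g).val := rfl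

theorem toZMod_comp_ofCrossed (ψ ξ : H1 G p) (A : C(G, ZMod (p ^ 2)))
    (hA : ∀ g, ZMod.castHom (dvd_pow_self p two_ne_zero) (ZMod p) (A g) = ψ.eval g)
    (hm : ∀ g h, A (g * h) =
      A g + A h + (p : ZMod (p ^ 2)) * (((ξ.eval h).val : ZMod (p ^ 2)) * A g)) :
    ψ.toMul = (toZMod p).comp (ofCrossed ξ A hm) := by
  ext g
  apply Multiplicative.toAdd.injective
  change ψ.eval g = (toZMod p (ofCrossed ξ A hm g)).toAdd
  rw [ofCrossed_apply, map_mul, map_pow, map_pow, toAdd_mul, toAdd_pow, toAdd_pow, toZMod_r,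
    toZMod_s, smul_zero, zero_add, nsmul_one, ← hA]
  conv_lhs => rw [← ZMod.natCast_zmod_val (A g), map_natCast]

/-- If `ψ` and `ξ` are independent, the homomorphism to `M_{p³}` is onto. -/
theorem ofCrossed_surjective (ψ ξ : H1 G p) (A : C(G, ZMod (p ^ 2)))
    (hA : ∀ g, ZMod.castHom (dvd_pow_self p two_ne_zero) (ZMod p) (A g) = ψ.eval g)
    (hm : ∀ g h, A (g * h) =
      A g + A h + (p : ZMod (p ^ 2)) * (((ξ.eval h).val : ZMod (p ^ 2)) * A g))
    {g k : G} (hg : ψ.eval g = 1) (hg' : ξ.eval g = 0) (hk : ξ.eval k = 1) :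
    Function.Surjective (ofCrossed ξ A hm) := by
  have hmem : ∀ x, ofCrossed ξ A hm x ∈ (ofCrossed ξ A hm).toMonoidHom.range := fun x => ⟨x, rfl⟩
  change Function.Surjective (ofCrossed ξ A hm).toMonoidHom
  refine MonoidHom.range_eq_top.1 ?_
  have hr : r p ∈ (ofCrossed ξ A hm).toMonoidHom.range := by
    obtain ⟨v, hv⟩ := ZMod.isUnit_of_castHom_ne_zero (x := A g) (by rw [hA, hg]; exact one_ne_zero)
    -- As `ξ(g) = 0`, the image of `g` is `r^A(g)` with `A(g)` a unit; the inverse exponent recovers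
    -- `r`.
    have := pow_mem (hmem g) (v⁻¹ : (ZMod (p ^ 2))ˣ).1.val
    rwa [ofCrossed_apply, hg', ZMod.val_zero, pow_zero, one_mul, ← pow_mul,
      pow_eq_pow_of_natCast_eq (b := 1) (r_pow p) (by simp [← hv]), pow_one] at this
  refine eq_top_of_r_mem_of_s_mem p hr ?_
  have := hmem k
  rw [ofCrossed_apply, hk, ZMod.val_one, pow_one] at this
  -- The image of `k` is `s * r^A(k)`.
  exact (Subgroup.mul_mem_cancel_right _ (pow_mem hr _)).1 this

end ModularGroup

/-! ### Dependent or independent `ψ` and `ξ` -/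

theorem H1.eval_pow {G : Type*} [Group G] [TopologicalSpace G] {q : ℕ} (ψ : H1 G q) (g : G)
    (n : ℕ) : ψ.eval (g ^ n) = n * ψ.eval g := by
  simp [H1.eval]

/-- Either `ξ` is a multiple of `ψ`, or `(ψ, ξ)` takes a value `(0, 1)`. -/
theorem H1.eq_mul_or_exists {p : ℕ} [Fact p.Prime] {G : Type*} [Group G] [TopologicalSpace G]
    (ψ ξ : H1 G p) {g₀ : G} (hg₀ : ψ.eval g₀ = 1) :
    (∀ g, ξ.eval g = ξ.eval g₀ * ψ.eval g) ∨ ∃ k, ψ.eval k = 0 ∧ ξ.eval k = 1 := by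
  refine or_iff_not_imp_left.2 fun h => ?_
  obtain ⟨g, hg⟩ := not_forall.1 h
  have hc : ξ.eval g - ξ.eval g₀ * ψ.eval g ≠ 0 := sub_ne_zero.2 hg
  -- The power of `g₀` moves `g` into the kernel of `ψ`, where `ξ` takes the nonzero value of `hc`;
  -- the outer exponent scales it to `1`.
  refine ⟨(g * g₀ ^ (-ψ.eval g).val) ^ (ξ.eval g - ξ.eval g₀ * ψ.eval g)⁻¹.val, ?_, ?_⟩
  · simp [eval_pow, eval_mul, hg₀]
  · rw [eval_pow, eval_mul, eval_pow, ZMod.natCast_zmod_val, ZMod.natCast_zmod_val]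
    convert inv_mul_cancel₀ hc using 2
    ring

end GaloisRel

theorem proposition10p2 (p : ℕ) [Fact p.Prime] (hp : p ≠ 2)
    (G : Type*) [Group G] [TopologicalSpace G] [IsTopologicalGroup G]
    [CompactSpace G] [TotallyDisconnectedSpace G]
    (hG : GaloisRel.IsGaloisRelationType p G)
    (ψ : G →ₜ* Multiplicative (ZMod p)) (hψ : Function.Surjective ψ) :
    (∃ Φ : G →ₜ* Multiplicative (ZMod (p ^ 2)), Function.Surjective Φ ∧
      ψ = (GaloisRel.reduction (dvd_pow_self p two_ne_zero)).comp Φ) ∨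
    (∃ Φ : G →ₜ* GaloisRel.ModularGroup p, Function.Surjective Φ ∧
      ψ = (GaloisRel.ModularGroup.toZMod p).comp Φ) := by
  obtain ⟨ξ, hξ⟩ := hG.exists_bockstein
  have h := hξ (Additive.ofMul ψ)
  obtain ⟨g₀, hg₀⟩ := hψ (Multiplicative.ofAdd 1)
  have hg₀ : H1.eval (Additive.ofMul ψ) g₀ = 1 := congrArg Multiplicative.toAdd hg₀
  rcases H1.eq_mul_or_exists (Additive.ofMul ψ) ξ hg₀ with hc | ⟨k, hk, hk'⟩
  · obtain ⟨Φ, hΦ⟩ := exists_hom_lift hp (Additive.ofMul ψ) ξ h _ hc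
    rw [toMul_ofMul] at hΦ
    exact Or.inl ⟨Φ, surjective_of_reduction_comp_surjective Φ (hΦ ▸ hψ), hΦ⟩
  · obtain ⟨A, hA, hm⟩ := exists_crossed_lift (Additive.ofMul ψ) ξ h
    -- Multiplying `g₀` by a power of `k` makes `ξ` vanish and keeps `ψ = 1`.
    refine Or.inr ⟨ModularGroup.ofCrossed ξ A hm, ModularGroup.ofCrossed_surjective
      (Additive.ofMul ψ) ξ A hA hm (g := g₀ * k ^ (-ξ.eval g₀).val) (k := k) ?_ ?_ hk',
      ModularGroup.toZMod_comp_ofCrossed (Additive.ofMul ψ) ξ A hA hm⟩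
    · simp [H1.eval_mul, H1.eval_pow, hk, hg₀]
    · simp [H1.eval_mul, H1.eval_pow, hk']
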